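/- All structures are finite, relational, and have a non-empty universe; all vocabularies are finite. Let $\mathcal{L}^k$ be infinitary logic (arbitrary conjunctions and disjunctions) with $k$ variables. For a collection $\mathcal{Q}$ of generalized (Lindström) quantifiers $Q_{\mathcal K}$, where each $\mathcal{K}$ is an isomorphism-closed class of structures of a fixed vocabulary, let $\mathcal{L}(\mathcal{Q})=\bigcup_{k\in\mathbb{N}}\mathcal{L}^k(\mathcal{Q})$ be the extension of $\mathcal{L}=\bigcup_k\mathcal{L}^k$ by the quantifiers in $\mathcal{Q}$. The arity of $Q_{\mathcal K}$ is the maximum arity of a relation symbol in the vocabulary of $\mathcal{K}$. $Q_{\mathcal K}$ is a CSP quantifier if $\mathcal{K}$ is the class of all structures $\mathbf{A}$ that admit a homomorphism $\mathbf{A}\to\mathbf{B}$, for some fixed template $\mathbf{B}$. For $\ell\ge 3$ let $n^\ell$ be the partial function with $n^\ell(a_1,\dots,a_\ell)=a$ if at least $\ell-1$ of the $a_i$ are equal to $a$, and undefined if there is no such $a$. For a structure $\mathbf{B}$ let $n^\ell(\mathbf{B})$ be the structure with the same universe and the same vocabulary in which each relation symbol $R$ is interpreted by the set of all defined results of applying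 $n^\ell$ componentwise to $\ell$ tuples of $R^{\mathbf{B}}$. The quantifier $Q_{\mathcal K}$ is $\mathcal{N}^\ell$-closed if, whenever $\mathbf{B}\in\mathcal{K}$ and $\mathbf{A}$ is a structure with the same universe satisfying $R^{\mathbf{A}}\subseteq R^{\mathbf{B}}\cup R^{n^\ell(\mathbf{B})}$ for all relation symbols $R$, also $\mathbf{A}\in\mathcal{K}$. Let $\mathcal{Q}^{\mathcal{N}^\ell_{\mathrm{CSP}}}_r$ be the collection of all $\mathcal{N}^\ell$-closed CSP quantifiers of arity at most $r$. Write $\mathcal{L}(\mathcal{Q})\le\mathcal{L}(\mathcal{Q}')$ if every sentence of $\mathcal{L}(\mathcal{Q})$, in any vocabulary, is equivalent (on all structures of that vocabulary) to a sentence of $\mathcal{L}(\mathcal{Q}')$, and $\mathcal{L}(\mathcal{Q})\lneq\mathcal{L}(\mathcal{Q}')$ if moreover $\mathcal{L}(\mathcal{Q}')\not\le\mathcal{L}(\mathcal{Q})$. **Statement.** Let $r\ge\ell\ge 3$. Then there is an $r'>r$ such that $\mathcal{L}(\mathcal{Q}^{\mathcal{N}^\ell_{\mathrm{CSP}}}_{r})\lneq\mathcal{L}(\mathcal{Q}^{\mathcal{N}^\ell_{\mathrm{CSP}}}_{r'})$.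 Consequently, for fixed $\ell$ there is an infinite strict arity hierarchy: there is a strictly increasing sequence $r=r_0<r_1<r_2<\cdots$ such that $\mathcal{L}(\mathcal{Q}^{\mathcal{N}^\ell_{\mathrm{CSP}}}_{r_n})\lneq\mathcal{L}(\mathcal{Q}^{\mathcal{N}^\ell_{\mathrm{CSP}}}_{r_{n+1}})$ for all $n\in\mathbb{N}$. -/

import Mathlib

namespace GenQuant

open scoped FirstOrder

/-- A finite relational structure over the vocabulary `τ` with non-empty universe.
(Vocabularies are relational and finite; this is required wherever they are quantified over.) -/
structure FinStr (τ : FirstOrder.Language.{0, 0}) : Type 1 where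
  carrier : Type
  str : τ.Structure carrier
  finite : Finite carrier
  nonempty : Nonempty carrier

attribute [instance] FinStr.str FinStr.finite FinStr.nonempty

/-- The finite structure on the universe of `A` with prescribed relations, in a relational
vocabulary `τ` (possibly different from that of `A`). -/
def FinStr.withRel {σ : FirstOrder.Language.{0, 0}} (A : FinStr σ) (τ : FirstOrder.Language.{0, 0}) [τ.IsRelational]
    (rel : ∀ n : ℕ, τ.Relations n → Set (Fin n → A.carrier)) : FinStr τ where
  carrier := A.carrier
  str :=
    { funMap := fun {_} f _ => isEmptyElim f
      RelMap := fun {n} R x => x ∈ rel n R }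
  finite := A.finite
  nonempty := A.nonempty

/-- The interpretation of the relation symbol `R` in `A`. -/
def FinStr.relation {τ : FirstOrder.Language.{0, 0}} (A : FinStr τ) {n : ℕ} (R : τ.Relations n) :
    Set (Fin n → A.carrier) :=
  {x | FirstOrder.Language.Structure.RelMap R x}

/-- A generalized (Lindström) quantifier `Q_K`: a finite relational vocabulary together with an
isomorphism-closed class `K` of finite structures in it. -/
structure Quantifier : Type 1 where
  voc : FirstOrder.Language.{0, 0}
  relational : voc.IsRelational
  finite : Finite (Σ n : ℕ, voc.Relations n)
  K : Set (FinStr voc)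
  iso_closed : ∀ A B : FinStr voc, Nonempty (A.carrier ≃[voc] B.carrier) → A ∈ K → B ∈ K

attribute [instance] Quantifier.relational Quantifier.finite

/-- The arity of the quantifier (maximal arity of a relation symbol of its vocabulary) is at
most `r`. -/
def Quantifier.ArityLE (Q : Quantifier) (r : ℕ) : Prop :=
  ∀ n : ℕ, Nonempty (Q.voc.Relations n) → n ≤ r

/-- `CSP(B)`: the class of finite structures that map homomorphically to `B`. -/
def CSP {τ : FirstOrder.Language.{0, 0}} (B : FinStr τ) : Set (FinStr τ) :=
  {A | Nonempty (A.carrier →[τ] B.carrier)}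

def Quantifier.IsCSP (Q : Quantifier) : Prop :=
  ∃ B : FinStr Q.voc, Q.K = CSP B

/-- A family of `ℓ`-ary partial functions `p_A : A^ℓ → A`. -/
abbrev PartialFamily (ℓ : ℕ) : Type 1 :=
  ∀ A : Type, (Fin ℓ → A) →. A

/-- `p(R)`: the results of applying `p` columnwise to `ℓ` tuples of `R`, where defined. -/
def applyRel {ℓ n : ℕ} {A : Type} (p : (Fin ℓ → A) →. A) (R : Set (Fin n → A)) :
    Set (Fin n → A) :=
  {c | ∃ M : Fin ℓ → Fin n → A, (∀ i, M i ∈ R) ∧ ∀ j, c j ∈ p (fun i => M i j)}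

/-- `Q_K` is `P`-closed: whenever `B ∈ K` and `A ≤ B ∪ p_B(B)` (same universe, each relation of
`A` is contained in `R^B ∪ p_B(R^B)`), also `A ∈ K`. -/
def Quantifier.IsClosed {ℓ : ℕ} (P : PartialFamily ℓ) (Q : Quantifier) : Prop :=
  ∀ B ∈ Q.K, ∀ rel : (∀ n : ℕ, Q.voc.Relations n → Set (Fin n → B.carrier)),
    (∀ (n : ℕ) (R : Q.voc.Relations n),
      rel n R ⊆ B.relation R ∪ applyRel (P B.carrier) (B.relation R)) →
    B.withRel Q.voc rel ∈ Q.K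

/-- The partial near-unanimity family: the value at `a` is `b` if at least `ℓ - 1` of the inputs
are equal to `b`, and it is undefined if there is no such `b` (`b` is unique if `ℓ ≥ 3`, see
`mem_nearUnanimity`). -/
noncomputable def nearUnanimity (ℓ : ℕ) : PartialFamily ℓ := fun _ a =>
  ⟨∃ b, ℓ - 1 ≤ {i : Fin ℓ | a i = b}.ncard, fun h => h.choose⟩

theorem mem_nearUnanimity {ℓ : ℕ} (hℓ : 3 ≤ ℓ) {A : Type} (a : Fin ℓ → A) (b : A) :
    b ∈ nearUnanimity ℓ A a ↔ ℓ - 1 ≤ {i : Fin ℓ | a i = b}.ncard := by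
  constructor
  · rintro ⟨h, rfl⟩
    exact h.choose_spec
  · intro hb
    refine ⟨⟨b, hb⟩, ?_⟩
    have h : ∃ b, ℓ - 1 ≤ {i : Fin ℓ | a i = b}.ncard := ⟨b, hb⟩
    change h.choose = b
    by_contra hne
    have hd : Disjoint {i : Fin ℓ | a i = h.choose} {i : Fin ℓ | a i = b} := by
      rw [Set.disjoint_left]
      intro i hi hi'
      exact hne (hi.symm.trans hi')
    have h1 := Set.ncard_union_eq hd (Set.toFinite _) (Set.toFinite _)
    have h2 := Set.ncard_le_card ({i : Fin ℓ | a i = h.choose} ∪ {i : Fin ℓ | a i = b})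
    have h3 := h.choose_spec
    rw [Nat.card_eq_fintype_card, Fintype.card_fin] at h2
    omega

/-- The collection of all `N^ℓ`-closed CSP quantifiers of arity at most `r`. -/
def nuCSPQuantifiers (ℓ r : ℕ) : Set Quantifier :=
  {Q | Q.IsCSP ∧ Q.IsClosed (nearUnanimity ℓ) ∧ Q.ArityLE r}

/-- The formulas of vocabulary `σ` of `𝓛^k(𝒬)`: infinitary logic with the `k` variables `Fin k`,
conjunctions over arbitrary sets, and the generalized quantifiers in `𝒬`.
(Disjunctions and universal quantification are obtained by negation.) In the formula
`Q ȳ₁,…,ȳ_m (ψ₁,…,ψ_m)` each `ȳ_i` is a tuple of distinct variables. -/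
inductive Formula (σ : FirstOrder.Language.{0, 0}) (𝒬 : Set Quantifier) (k : ℕ) : Type 1
  | eq (x y : Fin k) : Formula σ 𝒬 k
  | rel {n : ℕ} (R : σ.Relations n) (x : Fin n → Fin k) : Formula σ 𝒬 k
  | not (φ : Formula σ 𝒬 k) : Formula σ 𝒬 k
  | conj (ι : Type) (φ : ι → Formula σ 𝒬 k) : Formula σ 𝒬 k
  | ex (x : Fin k) (φ : Formula σ 𝒬 k) : Formula σ 𝒬 k
  | quant (Q : Quantifier) (hQ : Q ∈ 𝒬)
      (y : ∀ n : ℕ, Q.voc.Relations n → Fin n → Fin k)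
      (hy : ∀ (n : ℕ) (R : Q.voc.Relations n), Function.Injective (y n R))
      (ψ : ∀ n : ℕ, Q.voc.Relations n → Formula σ 𝒬 k) : Formula σ 𝒬 k

namespace Formula

variable {σ : FirstOrder.Language.{0, 0}} {𝒬 : Set Quantifier} {k : ℕ}

/-- The set of free variables. -/
def free : Formula σ 𝒬 k → Set (Fin k)
  | eq x y => {x, y}
  | rel _ x => Set.range x
  | not φ => φ.free
  | conj ι φ => ⋃ i : ι, (φ i).free
  | ex x φ => φ.free \ {x}
  | quant Q _ y _ ψ => ⋃ (n : ℕ) (R : Q.voc.Relations n), (ψ n R).free \ Set.range (y n R)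

/-- Satisfaction `(A, α) ⊨ φ`. Here `Function.extend y b α` is the assignment `α[b/y]`. -/
def Realize (A : FinStr σ) : Formula σ 𝒬 k → (Fin k → A.carrier) → Prop
  | eq x y, α => α x = α y
  | rel R x, α => (fun i => α (x i)) ∈ A.relation R
  | not φ, α => ¬ φ.Realize A α
  | conj ι φ, α => ∀ i : ι, (φ i).Realize A α
  | ex x φ, α => ∃ a : A.carrier, φ.Realize A (Function.update α x a)
  | quant Q _ y _ ψ, α =>
      A.withRel Q.voc (fun n R => {b | (ψ n R).Realize A (Function.extend (y n R) b α)}) ∈ Q.K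

def IsSentence (φ : Formula σ 𝒬 k) : Prop := φ.free = ∅

/-- Truth of a sentence in a structure (for sentences the assignment is irrelevant). -/
def Holds (A : FinStr σ) (φ : Formula σ 𝒬 k) : Prop :=
  ∀ α : Fin k → A.carrier, φ.Realize A α

end Formula

/-- `𝓛(𝒬) ≤ 𝓛(𝒬')`, where `𝓛 = ⋃_k 𝓛^k`: every sentence of `𝓛(𝒬)`, in any finite relational
vocabulary, is equivalent on finite structures to a sentence of `𝓛(𝒬')`. -/
def LogicLE (𝒬 𝒬' : Set Quantifier) : Prop :=
  ∀ σ : FirstOrder.Language.{0, 0}, σ.IsRelational → Finite (Σ n : ℕ, σ.Relations n) →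
    ∀ (k : ℕ) (φ : Formula σ 𝒬 k), φ.IsSentence →
      ∃ (k' : ℕ) (φ' : Formula σ 𝒬' k'), φ'.IsSentence ∧
        ∀ A : FinStr σ, φ.Holds A ↔ φ'.Holds A

/-- `𝓛(𝒬)` is strictly weaker than `𝓛(𝒬')`. -/
def LogicLT (𝒬 𝒬' : Set Quantifier) : Prop :=
  LogicLE 𝒬 𝒬' ∧ ¬ LogicLE 𝒬' 𝒬

end GenQuant

/-!
Take a maximum distance separable code `R` of length `n` and dimension `K`, and the template on `F`
whose `n`-ary relations are the cosets of `R`. If `3 * K ≤ n`, these are closed under majorities: if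
in each coordinate at most one of three codewords differs from `c`, then by pigeonhole two of the
codewords agree in at least `K` coordinates, so they coincide and are equal to `c`. Hence the CSP
quantifier of this template is near-unanimity-closed, and its arity is `n`.

Quantifiers of arity `r` cannot define it if `K = r + 4`. By a counting argument there are systems
of as many coset constraints as variables in which any few constraints have at least `n - 2`
variables per constraint, and for some right-hand side `d` such a system has no solution. It is
encoded as a structure on `V × F`, which belongs to the quantifier if and only if the system is
solvable. In the bijective pebble game on the structures for the right-hand sides `0` and `d`,
Duplicator shifts the fibres by an assignment whose values at the pebbles extend to solutions of any
few constraints. Before Spoiler moves `r` pebbles, she solves a core of constraints that are tied to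
the pebbled variables; the core is small by expansion. Any other few constraints can be solved
afterwards, one by one: each has at most four shared positions and at most `r` newly pebbled ones,
and the code allows the values in `r + 4` positions to be prescribed.
-/

namespace GenQuant

open scoped FirstOrder

/-! ### Maximum distance separable codes -/

section Codes

variable {ι F : Type*}

/-- `R` is a maximum distance separable (MDS) code of dimension `K`, i.e. any `K` coordinates form
an information set: they can be prescribed arbitrarily and they determine the codeword. The code
is only required to be additive. -/
structure IsMDS [AddGroup F] (K : ℕ) (R : AddSubgroup (ι → F)) : Prop where
  exists_eqOn : ∀ J : Finset ι, J.card ≤ K → ∀ w : ι → F, ∃ u ∈ R, Set.EqOn u w J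
  eq_of_eqOn : ∀ J : Finset ι, K ≤ J.card → ∀ u ∈ R, ∀ w ∈ R, Set.EqOn u w J → u = w

/-- The Reed–Solomon code of dimension `K` with evaluation points `α`, which provides MDS codes of
any length and dimension. -/
noncomputable def reedSolomon [Field F] (α : ι → F) (K : ℕ) : AddSubgroup (ι → F) :=
  ((Polynomial.degreeLT F K).map (LinearMap.pi fun i => Polynomial.leval (α i))).toAddSubgroup

theorem mem_reedSolomon [Field F] {α : ι → F} {K : ℕ} {u : ι → F} :
    u ∈ reedSolomon α K ↔ ∃ p : Polynomial F, p.degree < K ∧ (fun i => p.eval (α i)) = u := by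
  simp only [reedSolomon, Submodule.mem_toAddSubgroup, Submodule.mem_map,
    Polynomial.mem_degreeLT]
  rfl

theorem isMDS_reedSolomon [Field F] {α : ι → F} (hα : Function.Injective α) (K : ℕ) :
    IsMDS K (reedSolomon α K) := by
  classical
  refine ⟨fun J hJ w => ⟨_, mem_reedSolomon.2 ⟨Lagrange.interpolate J α w, ?_, rfl⟩,
    fun j hj => ?_⟩, fun J hJ u hu w hw huw => ?_⟩
  · exact (Lagrange.degree_interpolate_lt w hα.injOn).trans_le (by exact_mod_cast hJ)
  · exact Lagrange.eval_interpolate_at_node w hα.injOn hj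
  · obtain ⟨p, hp, rfl⟩ := mem_reedSolomon.1 hu
    obtain ⟨q, hq, rfl⟩ := mem_reedSolomon.1 hw
    have hKJ : (K : WithBot ℕ) ≤ J.card := by exact_mod_cast hJ
    rw [Polynomial.eq_of_degrees_lt_of_eval_index_eq J hα.injOn (hp.trans_le hKJ)
      (hq.trans_le hKJ) huw]

namespace IsMDS

variable [AddGroup F] [Fintype ι] {K : ℕ} {R : AddSubgroup (ι → F)}

theorem card_le [Finite F] (hR : IsMDS K R) (hK : K ≤ Fintype.card ι) :
    Nat.card R ≤ Nat.card F ^ K := by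
  obtain ⟨J, -, hJ⟩ := Finset.exists_subset_card_eq (s := (Finset.univ : Finset ι)) hK
  have hinj : Function.Injective fun (u : R) (j : J) => (u : ι → F) j := fun u w huw =>
    Subtype.ext <| hR.eq_of_eqOn J hJ.ge u u.2 w w.2 fun j hj => congrFun huw ⟨j, hj⟩
  simpa [Nat.card_fun, hJ] using Nat.card_le_card_of_injective _ hinj

theorem mem_of_majority (hR : IsMDS K R) (hK : 3 * K ≤ Fintype.card ι) {M : Fin 3 → ι → F}
    (hM : ∀ a, M a ∈ R) {c : ι → F} (hc : ∀ j a b, a ≠ b → M a j = c j ∨ M b j = c j) :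
    c ∈ R := by
  have exists_odd : ∀ j, ∃ a, ∀ b, b ≠ a → M b j = c j := by
    intro j
    by_contra! h
    obtain ⟨a, -, ha⟩ := h 0
    obtain ⟨b, hba, hb⟩ := h a
    exact (hc j b a hba).elim hb ha
  choose odd hodd using exists_odd
  obtain ⟨a, ha⟩ := Fintype.exists_le_card_fiber_of_mul_le_card odd (by simpa using hK)
  obtain ⟨b, b', hb, hb', hbb'⟩ : ∃ b b', b ≠ a ∧ b' ≠ a ∧ b ≠ b' := by
    clear ha
    decide +revert
  have heq : M b = M b' := by
    refine hR.eq_of_eqOn _ ha _ (hM b) _ (hM b') fun j hj => ?_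
    obtain rfl : odd j = a := by simpa using hj
    rw [hodd j b hb, hodd j b' hb']
  have hcb : M b = c :=
    funext fun j => (hc j b b' hbb').elim id fun h => (congrFun heq j).trans h
  exact hcb ▸ hM b

end IsMDS

end Codes

/-! ### Expanding constraint systems -/

section Expansion

variable {E V ι : Type*} [Fintype ι] [DecidableEq V]

/-- The set of variables of the constraints in `S`, where the constraint `e` has the variable
`f e i` in position `i`. -/
def varsOf (f : E → ι → V) (S : Finset E) : Finset V :=
  S.biUnion fun e => Finset.univ.image (f e)

theorem varsOf_subset_iff {f : E → ι → V} {S : Finset E} {W : Finset V} :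
    varsOf f S ⊆ W ↔ ∀ e ∈ S, ∀ i, f e i ∈ W := by
  simp [varsOf, Finset.subset_iff]
  grind

/-- Any set of at most `g` constraints of arity `n` has at least `n - 2` variables per
constraint. -/
def Expanding (f : E → ι → V) (g : ℕ) : Prop :=
  ∀ S : Finset E, S.card ≤ g → Fintype.card ι * S.card ≤ (varsOf f S).card + 2 * S.card

/-- Some `s` constraints have all their variables among some `w` variables. Non-expanding systems
are counted by means of this property. -/
def Crowded (f : E → ι → V) (s w : ℕ) : Prop :=
  ∃ (S : Finset E) (W : Finset V), S.card = s ∧ W.card = w ∧ varsOf f S ⊆ W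

theorem exists_crowded_of_not_expanding [Fintype V] {f : E → ι → V} {g : ℕ}
    (hf : ¬ Expanding f g) (hV : (Fintype.card ι - 2) * g ≤ Fintype.card V) :
    ∃ s ∈ Finset.Icc 1 g, Crowded f s ((Fintype.card ι - 2) * s) := by
  unfold Expanding at hf
  push Not at hf
  obtain ⟨S, hSg, hS⟩ := hf
  have hpos : 0 < S.card := by
    by_contra! h
    simp [Nat.le_zero.1 h] at hS
  have hvars : (varsOf f S).card ≤ (Fintype.card ι - 2) * S.card := by
    rw [Nat.sub_mul]
    omega
  obtain ⟨W, hSW, hW⟩ :=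
    Finset.exists_superset_card_eq hvars ((Nat.mul_le_mul_left _ hSg).trans hV)
  exact ⟨S.card, Finset.mem_Icc.2 ⟨hpos, hSg⟩, S, W, rfl, hW, hSW⟩

section Counting

variable [Fintype E] [Fintype V] [DecidableEq E] [DecidableEq ι]

theorem card_filter_varsOf_subset_mul (S : Finset E) (W : Finset V) :
    (Finset.univ.filter fun f : E → ι → V => varsOf f S ⊆ W).card *
        (Fintype.card V ^ Fintype.card ι) ^ S.card =
      (W.card ^ Fintype.card ι) ^ S.card *
        (Fintype.card V ^ Fintype.card ι) ^ Fintype.card E := by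
  have hpi : (Finset.univ.filter fun f : E → ι → V => varsOf f S ⊆ W) =
      Fintype.piFinset fun e => Fintype.piFinset fun _ => if e ∈ S then W else Finset.univ := by
    ext f
    simp only [Finset.mem_filter, Finset.mem_univ, true_and, varsOf_subset_iff,
      Fintype.mem_piFinset]
    refine forall_congr' fun e => ?_
    by_cases he : e ∈ S <;> simp [he]
  have hS : (Finset.univ.filter fun e => e ∉ S).card + S.card = Fintype.card E := by
    rw [Finset.filter_not, Finset.filter_mem_eq_inter, Finset.univ_inter,
      ← Finset.compl_eq_univ_sdiff, Finset.card_compl_add_card]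
  simp only [hpi, Fintype.card_piFinset, Finset.prod_const, Finset.card_univ,
    apply_ite Finset.card, ite_pow, Finset.prod_ite, Finset.filter_mem_eq_inter,
    Finset.univ_inter]
  rw [mul_assoc, ← pow_add, hS]

open scoped Classical in
theorem card_filter_crowded_mul_le (s w : ℕ) :
    (Finset.univ.filter fun f : E → ι → V => Crowded f s w).card *
        (Fintype.card V ^ Fintype.card ι) ^ s ≤
      Fintype.card E ^ s * Fintype.card V ^ w *
        ((w ^ Fintype.card ι) ^ s * (Fintype.card V ^ Fintype.card ι) ^ Fintype.card E) := by
  let pairs : Finset (Finset E × Finset V) :=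
    Finset.powersetCard s Finset.univ ×ˢ Finset.powersetCard w Finset.univ
  have hpairs : pairs.card ≤ Fintype.card E ^ s * Fintype.card V ^ w := by
    simpa [pairs] using Nat.mul_le_mul (Nat.choose_le_pow _ s) (Nat.choose_le_pow _ w)
  have hcover : (Finset.univ.filter fun f : E → ι → V => Crowded f s w) ⊆
      pairs.biUnion fun q => Finset.univ.filter fun f => varsOf f q.1 ⊆ q.2 := by
    intro f hf
    obtain ⟨S, W, hS, hW, hf⟩ := (Finset.mem_filter.1 hf).2
    exact Finset.mem_biUnion.2 ⟨(S, W), by simp [pairs, hS, hW], by simpa using hf⟩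
  calc _ ≤ (∑ q ∈ pairs, (Finset.univ.filter fun f : E → ι → V => varsOf f q.1 ⊆ q.2).card) *
        (Fintype.card V ^ Fintype.card ι) ^ s := by
        gcongr
        exact (Finset.card_le_card hcover).trans Finset.card_biUnion_le
    _ = ∑ _q ∈ pairs,
        (w ^ Fintype.card ι) ^ s * (Fintype.card V ^ Fintype.card ι) ^ Fintype.card E := by
        rw [Finset.sum_mul]
        refine Finset.sum_congr rfl fun _ hq => ?_
        obtain ⟨hS, hW⟩ := Finset.mem_product.1 hq
        rw [← (Finset.mem_powersetCard.1 hS).2, ← (Finset.mem_powersetCard.1 hW).2,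
          card_filter_varsOf_subset_mul]
    _ ≤ _ := by
        rw [Finset.sum_const, smul_eq_mul]
        gcongr

open scoped Classical in
theorem card_filter_crowded_mul_card_le (hEV : Fintype.card E ≤ Fintype.card V)
    (hι : 2 ≤ Fintype.card ι) {s : ℕ} (hs : 0 < s) :
    (Finset.univ.filter fun f : E → ι → V => Crowded f s ((Fintype.card ι - 2) * s)).card *
        Fintype.card V ≤
      (((Fintype.card ι - 2) * s) ^ Fintype.card ι) ^ s *
        (Fintype.card V ^ Fintype.card ι) ^ Fintype.card E := by
  obtain hV | hV := (Fintype.card V).eq_zero_or_pos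
  · simp [hV]
  have hcount := card_filter_crowded_mul_le (E := E) (V := V) (ι := ι) s ((Fintype.card ι - 2) * s)
  set n := Fintype.card ι
  set v := Fintype.card V
  set bad := (Finset.univ.filter fun f : E → ι → V => Crowded f s ((n - 2) * s)).card
  set choices := v ^ s * v ^ ((n - 2) * s)
  -- Of the `n` positions of a constraint, `n - 2` are paid for by the choice of the `(n - 2) * s`
  -- variables and one by the choice of the constraint, so each constraint saves a factor `v`.
  have hpow : (v ^ n) ^ s = choices * v ^ s := by
    obtain ⟨k, hk⟩ := Nat.exists_eq_add_of_le' hι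
    simp only [choices, hk, Nat.add_sub_cancel]
    ring
  have h : choices * (bad * v) ≤
      choices * ((((n - 2) * s) ^ n) ^ s * (v ^ n) ^ Fintype.card E) := by
    calc choices * (bad * v) ≤ choices * (bad * v ^ s) := by
          gcongr
          exact Nat.le_self_pow hs.ne' v
      _ = bad * (v ^ n) ^ s := by rw [hpow]; ring
      _ ≤ Fintype.card E ^ s * v ^ ((n - 2) * s) * _ := hcount
      _ ≤ choices * _ := Nat.mul_le_mul_right _ (Nat.mul_le_mul_right _ (Nat.pow_le_pow_left hEV s))
  exact Nat.le_of_mul_le_mul_left h (by positivity)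

end Counting

end Expansion

theorem exists_expanding {ι : Type*} [Fintype ι] (hι : 2 ≤ Fintype.card ι) (g : ℕ) :
    ∃ (N : ℕ) (f : Fin (N + 1) → ι → Fin (N + 1)), Expanding f g := by
  classical
  let c : ℕ → ℕ := fun s => (((Fintype.card ι - 2) * s) ^ Fintype.card ι) ^ s
  let N := (Fintype.card ι - 2) * g + ∑ s ∈ Finset.Icc 1 g, c s
  refine ⟨N, ?_⟩
  by_contra! hbad
  let total := ((N + 1) ^ Fintype.card ι) ^ (N + 1)
  let bad : ℕ → Finset (Fin (N + 1) → ι → Fin (N + 1)) := fun s =>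
    Finset.univ.filter fun f => Crowded f s ((Fintype.card ι - 2) * s)
  have hcover : Finset.univ ⊆ (Finset.Icc 1 g).biUnion bad := by
    intro f _
    obtain ⟨s, hs, h⟩ := exists_crowded_of_not_expanding (hbad f) (by simp [N]; omega)
    exact Finset.mem_biUnion.2 ⟨s, hs, Finset.mem_filter.2 ⟨Finset.mem_univ _, h⟩⟩
  have hle : total * (N + 1) ≤ total * ∑ s ∈ Finset.Icc 1 g, c s := by
    calc total * (N + 1)
        ≤ (∑ s ∈ Finset.Icc 1 g, (bad s).card) * (N + 1) := by
          gcongr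
          simpa [total] using (Finset.card_le_card hcover).trans Finset.card_biUnion_le
      _ = ∑ s ∈ Finset.Icc 1 g, (bad s).card * (N + 1) := Finset.sum_mul _ _ _
      _ ≤ ∑ s ∈ Finset.Icc 1 g, c s * total := by
          refine Finset.sum_le_sum fun s hs => ?_
          simpa [c, total, bad] using card_filter_crowded_mul_card_le
            (E := Fin (N + 1)) (V := Fin (N + 1)) le_rfl hι (Finset.mem_Icc.1 hs).1
      _ = total * ∑ s ∈ Finset.Icc 1 g, c s := by rw [← Finset.sum_mul, mul_comm]
  have hN : N + 1 ≤ ∑ s ∈ Finset.Icc 1 g, c s := Nat.le_of_mul_le_mul_left hle (by positivity)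
  omega

/-! ### Systems of coset constraints -/

section Systems

variable {E V ι F : Type*} [AddCommGroup F] (f : E → ι → V) (R : AddSubgroup (ι → F))
  (d : E → ι → F)

/-- The assignment `z` satisfies the constraint `e`: the tuple of values of its variables lies in
the coset `d e + R`. -/
def Sat (z : V → F) (e : E) : Prop :=
  z ∘ f e - d e ∈ R

/-- The partial assignment `x` restricted to `P` extends to a solution of any few constraints, where
the number of constraints is the bound of `IsCore.card_le`. This is the invariant of Duplicator in
the pebble game. -/
def Extendable (P : Finset V) (x : V → F) : Prop :=
  ∀ S : Finset E, S.card ≤ 2 * P.card →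
    ∃ z : V → F, Set.EqOn z x P ∧ ∀ e ∈ S, Sat f R d z e

variable {f R d}

theorem Extendable.sat [Nonempty ι] {P : Finset V} {x : V → F} {e : E}
    (hx : Extendable f R d P x) (he : ∀ i, f e i ∈ P) : Sat f R d x e := by
  have hP : 0 < P.card := Finset.card_pos.2 ⟨_, he (Classical.arbitrary ι)⟩
  obtain ⟨z, hzx, hz⟩ := hx {e} (by rw [Finset.card_singleton]; omega)
  have hze : z ∘ f e = x ∘ f e := funext fun i => hzx (he i)
  simpa only [Sat, hze] using hz e (Finset.mem_singleton_self e)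

end Systems

/-! ### Peeling off constraints with many private positions -/

section Peeling

variable {E V ι : Type*} [Fintype ι] (f : E → ι → V)

open scoped Classical in
/-- The positions of the constraint `e` which are private relative to `S` and `P`: their variable is
outside `P` and has no other occurrence in the constraints of `S`. The values of these variables can
be changed without affecting `P` and the remaining constraints. -/
noncomputable def privatePos (S : Finset E) (P : Finset V) (e : E) : Finset ι :=
  Finset.univ.filter fun i => f e i ∉ P ∧ ∀ e' ∈ S, ∀ i', f e' i' = f e i → e' = e ∧ i' = i

variable {f} {S S' C : Finset E} {P T U : Finset V} {e : E}

theorem mem_privatePos {i : ι} :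
    i ∈ privatePos f S P e ↔
      f e i ∉ P ∧ ∀ e' ∈ S, ∀ i', f e' i' = f e i → e' = e ∧ i' = i := by
  simp [privatePos]

theorem privatePos_anti (h : S ⊆ S') : privatePos f S' P e ⊆ privatePos f S P e := by
  intro i hi
  rw [mem_privatePos] at hi ⊢
  exact ⟨hi.1, fun e' he' => hi.2 e' (h he')⟩

theorem card_privatePos_le_card_privatePos_union_add [DecidableEq V] (he : e ∈ S) :
    (privatePos f S P e).card ≤ (privatePos f S (P ∪ T) e).card + T.card := by
  classical
  have hinj : Set.InjOn (f e) (privatePos f S P e) := fun i _ j hj hij =>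
    ((mem_privatePos.1 hj).2 e he i hij).2
  have hT : ((privatePos f S P e).filter fun i => f e i ∈ T).card ≤ T.card :=
    Finset.card_le_card_of_injOn (f e) (fun i hi => (Finset.mem_filter.1 hi).2)
      (hinj.mono (Finset.filter_subset _ _))
  have hcompl : ((privatePos f S P e).filter fun i => f e i ∉ T) ⊆ privatePos f S (P ∪ T) e := by
    intro i hi
    obtain ⟨hi, hiT⟩ := Finset.mem_filter.1 hi
    obtain ⟨hiP, hpriv⟩ := mem_privatePos.1 hi
    exact mem_privatePos.2 ⟨by simp [hiP, hiT], hpriv⟩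
  have hle := Finset.card_le_card hcompl
  have hsplit := Finset.card_filter_add_card_filter_not (s := privatePos f S P e)
    (fun i => f e i ∈ T)
  omega

/-- The set `S` of constraints is a core over `P` if each of its constraints has at least five
positions that are not private. Constraints outside a core can be peeled off one by one. -/
def IsCore (f : E → ι → V) (P : Finset V) (S : Finset E) : Prop :=
  ∀ e ∈ S, (privatePos f S P e).card + 5 ≤ Fintype.card ι

theorem IsCore.exists_mem_notMem (hC : IsCore f P C) (hCS : C ⊆ S) (hS : ¬ IsCore f P S) :
    ∃ e ∈ S, e ∉ C ∧ Fintype.card ι ≤ (privatePos f S P e).card + 4 := by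
  unfold IsCore at hS
  push Not at hS
  obtain ⟨e, he, hlt⟩ := hS
  refine ⟨e, he, fun heC => ?_, by omega⟩
  have hcore := hC e heC
  have hanti := Finset.card_le_card (privatePos_anti (f := f) (P := P) (e := e) hCS)
  omega

section

variable [DecidableEq V]

theorem two_mul_card_varsOf_le (f : E → ι → V) (S : Finset E) (P : Finset V) :
    2 * (varsOf f S).card ≤
      2 * P.card + ∑ e ∈ S, (privatePos f S P e).card + Fintype.card ι * S.card := by
  let occ : Finset (Σ _ : E, ι) := S.sigma fun _ => Finset.univ
  let privateOcc : Finset (Σ _ : E, ι) := S.sigma (privatePos f S P)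
  let W := varsOf f S \ P
  -- A variable outside `P` occurs twice, or its only occurrence is private.
  have hW : ∀ v ∈ W, 2 ≤ (occ.filter fun q => f q.1 q.2 = v).card +
      (privateOcc.filter fun q => f q.1 q.2 = v).card := by
    intro v hv
    obtain ⟨hvS, hvP⟩ := Finset.mem_sdiff.1 hv
    obtain ⟨e, he, i, rfl⟩ : ∃ e ∈ S, ∃ i, f e i = v := by simpa [varsOf] using hvS
    have hei : (⟨e, i⟩ : Σ _ : E, ι) ∈ occ.filter fun q => f q.1 q.2 = f e i := by
      simp [occ, he]
    obtain hone | htwo := Nat.lt_or_ge (occ.filter fun q => f q.1 q.2 = f e i).card 2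
    · have hpriv : i ∈ privatePos f S P e := mem_privatePos.2 ⟨hvP, fun e' he' i' h => by
        have heq : (⟨e', i'⟩ : Σ _ : E, ι) = ⟨e, i⟩ :=
          Finset.card_le_one.1 (Nat.le_of_lt_succ hone) _ (by simp [occ, he', h]) _ hei
        simpa using heq⟩
      have hei' : (⟨e, i⟩ : Σ _ : E, ι) ∈ privateOcc.filter fun q => f q.1 q.2 = f e i := by
        simp [privateOcc, he, hpriv]
      exact add_le_add (Finset.one_le_card.2 ⟨_, hei⟩) (Finset.one_le_card.2 ⟨_, hei'⟩)
    · exact htwo.trans (Nat.le_add_right _ _)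
  have hsum : 2 * W.card ≤ occ.card + privateOcc.card := by
    calc 2 * W.card = ∑ _v ∈ W, 2 := by rw [Finset.sum_const, smul_eq_mul, mul_comm]
      _ ≤ _ := Finset.sum_le_sum hW
      _ ≤ occ.card + privateOcc.card := by
        rw [Finset.sum_add_distrib, Finset.sum_card_fiberwise_eq_card_filter,
          Finset.sum_card_fiberwise_eq_card_filter]
        exact add_le_add (Finset.card_filter_le _ _) (Finset.card_filter_le _ _)
  have hocc : occ.card = Fintype.card ι * S.card := by
    simp [occ, Finset.card_sigma, mul_comm]
  rw [hocc, Finset.card_sigma] at hsum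
  have hvars : (varsOf f S).card ≤ W.card + P.card := Finset.card_le_card_sdiff_add_card
  omega

theorem IsCore.card_le {g : ℕ} (hS : IsCore f P S) (hf : Expanding f g) (hg : S.card ≤ g) :
    S.card ≤ 2 * P.card := by
  have hpriv : ∑ e ∈ S, (privatePos f S P e).card + 5 * S.card ≤ Fintype.card ι * S.card := by
    calc _ = ∑ e ∈ S, ((privatePos f S P e).card + 5) := by
          rw [Finset.sum_add_distrib, Finset.sum_const, smul_eq_mul, mul_comm]
      _ ≤ ∑ _e ∈ S, Fintype.card ι := Finset.sum_le_sum hS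
      _ = _ := by rw [Finset.sum_const, smul_eq_mul, mul_comm]
  have hcount := two_mul_card_varsOf_le f S P
  have hexp := hf S hg
  omega

end

variable {F : Type*} [AddCommGroup F] {R : AddSubgroup (ι → F)} {d : E → ι → F}

theorem exists_sat_of_sat_erase [DecidableEq E] {K : ℕ} (hR : IsMDS K R) (he : e ∈ S)
    (hK : Fintype.card ι ≤ (privatePos f S U e).card + K) {z : V → F}
    (hz : ∀ e' ∈ S.erase e, Sat f R d z e') :
    ∃ z' : V → F, Set.EqOn z' z U ∧ ∀ e' ∈ S, Sat f R d z' e' := by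
  classical
  let I := privatePos f S U e
  have hI : Iᶜ.card ≤ K := by rwa [Finset.card_compl, Nat.sub_le_iff_le_add']
  obtain ⟨u, hu, huz⟩ := hR.exists_eqOn Iᶜ hI (z ∘ f e - d e)
  let z' : V → F := Function.extend (fun i : I => f e i) (fun i => u i + d e i) z
  have hpriv : ∀ {e' i'} (j : I), e' ∈ S → f e j = f e' i' → e' = e ∧ i' = j := fun j he' h =>
    (mem_privatePos.1 j.2).2 _ he' _ h.symm
  have hz'z : ∀ v, (∀ j : I, f e j ≠ v) → z' v = z v := fun v hv =>
    Function.extend_apply' _ _ v fun ⟨j, hj⟩ => hv j hj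
  have hz'e : ∀ i, z' (f e i) = u i + d e i := by
    intro i
    by_cases hi : i ∈ I
    · have hinj : Function.Injective fun j : I => f e j := fun j k h =>
        Subtype.ext (hpriv k he h.symm).2
      exact hinj.extend_apply _ _ ⟨i, hi⟩
    · have hui : u i = z (f e i) - d e i := huz (Finset.mem_coe.2 (Finset.mem_compl.2 hi))
      rw [hui, sub_add_cancel]
      exact hz'z _ fun j hj => hi ((hpriv j he hj).2 ▸ j.2)
  refine ⟨z', fun v hv => hz'z v fun j hj => ?_, fun e' he' => ?_⟩
  · exact (mem_privatePos.1 j.2).1 (hj ▸ hv)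
  · by_cases hee : e' = e
    · subst hee
      have hu' : z' ∘ f e' - d e' = u := funext fun i => by simp [hz'e]
      rwa [Sat, hu']
    · have heq : z' ∘ f e' = z ∘ f e' := funext fun i =>
        hz'z _ fun j hj => hee (hpriv j he' hj).1
      rw [Sat, heq]
      exact hz e' (Finset.mem_erase.2 ⟨hee, he'⟩)

section

variable [DecidableEq V]

theorem exists_sat_of_maximal_core {r g : ℕ} (hR : IsMDS (r + 4) R)
    (hC : Maximal (fun S => IsCore f P S ∧ S.card ≤ g) C) {y : V → F}
    (hy : ∀ e ∈ C, Sat f R d y e) (hT : T.card ≤ r) (S : Finset E) (hCS : C ⊆ S)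
    (hS : S.card ≤ g) :
    ∃ z : V → F, Set.EqOn z y ↑(P ∪ T) ∧ ∀ e ∈ S, Sat f R d z e := by
  classical
  induction S using Finset.strongInduction with
  | H S ih =>
    by_cases hcore : IsCore f P S
    · exact ⟨y, Set.eqOn_refl _ _, fun e he => hy e (hC.2 ⟨hcore, hS⟩ hCS he)⟩
    obtain ⟨e, he, heC, hcard⟩ := hC.1.1.exists_mem_notMem hCS hcore
    obtain ⟨z, hzy, hz⟩ := ih _ (Finset.erase_ssubset he) (Finset.subset_erase.2 ⟨hCS, heC⟩)
      ((Finset.card_erase_le).trans hS)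
    have hunion := card_privatePos_le_card_privatePos_union_add (f := f) (P := P) (T := T) he
    obtain ⟨z', hz'z, hz'⟩ := exists_sat_of_sat_erase (U := P ∪ T) hR he (by omega) hz
    exact ⟨z', hz'z.trans hzy, hz'⟩

theorem Extendable.exists_extension [Finite E] {r m : ℕ} (hR : IsMDS (r + 4) R)
    (hf : Expanding f (4 * m)) (hP : P.card ≤ m) {x : V → F} (hx : Extendable f R d P x) :
    ∃ y : V → F, Set.EqOn y x P ∧ ∀ T : Finset V, T.card ≤ r →
      ∀ P' ⊆ P ∪ T, P'.card ≤ m → Extendable f R d P' y := by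
  classical
  obtain ⟨C, hC⟩ := (Set.toFinite {S | IsCore f P S ∧ S.card ≤ 4 * m}).exists_maximal
    ⟨∅, by simp [IsCore]⟩
  have hC2 : C.card ≤ 2 * P.card := hC.1.1.card_le hf hC.1.2
  obtain ⟨y, hyx, hy⟩ := hx C hC2
  refine ⟨y, hyx, fun T hT P' hP' hPm S hS => ?_⟩
  obtain ⟨z, hzy, hz⟩ := exists_sat_of_maximal_core hR hC hy hT (C ∪ S)
    Finset.subset_union_left ((Finset.card_union_le _ _).trans (by omega))
  exact ⟨z, hzy.mono (Finset.coe_subset.2 hP'), fun e he => hz e (Finset.mem_union_right _ he)⟩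

end

theorem exists_unsatisfiable [Finite E] [Nonempty E] [Finite V] [Finite F]
    (hVE : Nat.card V ≤ Nat.card E)
    (hR : Nat.card R * Nat.card F < Nat.card F ^ Fintype.card ι) :
    ∃ d : E → ι → F, ∀ z : V → F, ∃ e, ¬ Sat f R d z e := by
  by_contra! h
  let rhs : (V → F) × (E → R) → E → ι → F := fun q e => q.1 ∘ f e - q.2 e
  have hrhs : Function.Surjective rhs := by
    intro d
    obtain ⟨z, hz⟩ := h d
    exact ⟨(z, fun e => ⟨_, hz e⟩), funext fun e => sub_sub_cancel _ _⟩
  have hle : (Nat.card F ^ Fintype.card ι) ^ Nat.card E ≤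
      (Nat.card R * Nat.card F) ^ Nat.card E := by
    calc _ ≤ Nat.card F ^ Nat.card V * Nat.card R ^ Nat.card E := by
          simpa [Nat.card_fun] using Nat.card_le_card_of_surjective _ hrhs
      _ ≤ Nat.card F ^ Nat.card E * Nat.card R ^ Nat.card E := by
          gcongr
          exact Nat.card_pos
      _ = _ := by rw [mul_pow, mul_comm]
  exact (Nat.pow_lt_pow_left hR Nat.card_pos.ne').not_ge hle

end Peeling

/-! ### Formulas and bijective games -/

namespace Formula

variable {σ : FirstOrder.Language.{0, 0}} {𝒬 𝒬' : Set Quantifier} {k : ℕ}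

theorem realize_congr (A : FinStr σ) (φ : Formula σ 𝒬 k) {α β : Fin k → A.carrier}
    (h : Set.EqOn α β φ.free) : φ.Realize A α ↔ φ.Realize A β := by
  induction φ generalizing α β with
  | eq x y => simp only [Realize, h (show x ∈ _ by simp [free]), h (show y ∈ _ by simp [free])]
  | rel R x =>
    have hx : (fun i => α (x i)) = fun i => β (x i) := funext fun i => h ⟨i, rfl⟩
    simp only [Realize, hx]
  | not φ ih => exact not_congr (ih h)
  | conj ι φ ih =>
    exact forall_congr' fun i => ih i (h.mono (Set.subset_iUnion (fun i => (φ i).free) i))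
  | ex x φ ih =>
    refine exists_congr fun a => ih fun i hi => ?_
    obtain rfl | hx := eq_or_ne i x
    · simp only [Function.update_self]
    · simpa only [Function.update_of_ne hx] using h ⟨hi, hx⟩
  | quant Q hQ y hy ψ ih =>
    have hrel : ∀ n R b, (ψ n R).Realize A (Function.extend (y n R) b α) ↔
        (ψ n R).Realize A (Function.extend (y n R) b β) := by
      refine fun n R b => ih n R fun i hi => ?_
      by_cases hx : ∃ j, y n R j = i
      · obtain ⟨j, rfl⟩ := hx
        simp only [(hy n R).extend_apply]
      · simpa only [Function.extend_apply' _ _ _ hx] using h (Set.mem_iUnion₂.2 ⟨n, R, hi, hx⟩)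
    simp only [Realize, hrel]

theorem IsSentence.holds_iff {φ : Formula σ 𝒬 k} (hφ : φ.IsSentence) (A : FinStr σ)
    (α : Fin k → A.carrier) : φ.Holds A ↔ φ.Realize A α :=
  ⟨fun h => h α, fun h β => (realize_congr A φ (hφ ▸ Set.eqOn_empty α β)).1 h⟩

/-- A formula over `𝒬`, regarded as a formula over a larger collection `𝒬'` of quantifiers. -/
def inclusion (h : 𝒬 ⊆ 𝒬') : Formula σ 𝒬 k → Formula σ 𝒬' k
  | eq x y => eq x y
  | rel R x => rel R x
  | not φ => not (φ.inclusion h)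
  | conj ι φ => conj ι fun i => (φ i).inclusion h
  | ex x φ => ex x (φ.inclusion h)
  | quant Q hQ y hy ψ => quant Q (h hQ) y hy fun n R => (ψ n R).inclusion h

theorem free_inclusion (h : 𝒬 ⊆ 𝒬') (φ : Formula σ 𝒬 k) : (φ.inclusion h).free = φ.free := by
  induction φ with
  | eq | rel => rfl
  | not _ ih => exact ih
  | conj | ex | quant => simp only [inclusion, free, *]

theorem realize_inclusion (h : 𝒬 ⊆ 𝒬') (A : FinStr σ) (φ : Formula σ 𝒬 k)
    (α : Fin k → A.carrier) : (φ.inclusion h).Realize A α ↔ φ.Realize A α := by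
  induction φ generalizing α with
  | eq | rel => exact Iff.rfl
  | not φ ih => exact not_congr (ih α)
  | conj | ex | quant => simp only [inclusion, Realize, *]

end Formula

theorem LogicLE.of_subset {𝒬 𝒬' : Set Quantifier} (h : 𝒬 ⊆ 𝒬') : LogicLE 𝒬 𝒬' :=
  fun _ _ _ k φ hφ => ⟨k, φ.inclusion h, (φ.free_inclusion h).trans hφ, fun A =>
    forall_congr' fun α => (φ.realize_inclusion h A α).symm⟩

theorem Quantifier.ArityLE.mono {Q : Quantifier} {r s : ℕ} (hQ : Q.ArityLE r) (h : r ≤ s) :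
    Q.ArityLE s :=
  fun n hn => (hQ n hn).trans h

theorem nuCSPQuantifiers_mono (ℓ : ℕ) : Monotone (nuCSPQuantifiers ℓ) :=
  fun _ _ h _ hQ => ⟨hQ.1, hQ.2.1, hQ.2.2.mono h⟩

namespace Quantifier

variable (Q : Quantifier)

theorem mem_iff_of_equiv {A B : FinStr Q.voc} (h : A.carrier ≃ B.carrier)
    (hrel : ∀ n (R : Q.voc.Relations n) t, h ∘ t ∈ B.relation R ↔ t ∈ A.relation R) :
    A ∈ Q.K ↔ B ∈ Q.K := by
  let e : A.carrier ≃[Q.voc] B.carrier :=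
    { toEquiv := h
      map_fun' := fun f _ => isEmptyElim f
      map_rel' := fun {n} R t => hrel n R t }
  exact ⟨Q.iso_closed _ _ ⟨e⟩, Q.iso_closed _ _ ⟨e.symm⟩⟩

/-- The sentence `Q ȳ (R(ȳ))_R` that defines the class `Q.K`. -/
def sentence {𝒬 : Set Quantifier} (hQ : Q ∈ 𝒬) {s : ℕ} (hs : Q.ArityLE s) : Formula Q.voc 𝒬 s :=
  .quant Q hQ (fun n R => Fin.castLE (hs n ⟨R⟩)) (fun _ _ => Fin.castLE_injective _)
    fun n R => .rel R (Fin.castLE (hs n ⟨R⟩))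

variable {Q} {𝒬 : Set Quantifier} {s : ℕ}

theorem isSentence_sentence (hQ : Q ∈ 𝒬) (hs : Q.ArityLE s) : (Q.sentence hQ hs).IsSentence := by
  simp [Formula.IsSentence, sentence, Formula.free]

theorem holds_sentence_iff (hQ : Q ∈ 𝒬) (hs : Q.ArityLE s) (A : FinStr Q.voc) :
    (Q.sentence hQ hs).Holds A ↔ A ∈ Q.K := by
  let α : Fin s → A.carrier := fun _ => Classical.arbitrary _
  have hext : ∀ n R (t : Fin n → A.carrier),
      (fun i => Function.extend (Fin.castLE (hs n ⟨R⟩)) t α (Fin.castLE (hs n ⟨R⟩) i)) = t :=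
    fun n R t => funext ((Fin.castLE_injective (hs n ⟨R⟩)).extend_apply t α)
  rw [(isSentence_sentence hQ hs).holds_iff A α]
  refine Q.mem_iff_of_equiv (.refl _) fun n R t => ?_
  exact (iff_of_eq (congrArg (· ∈ A.relation R) (hext n R t))).symm

end Quantifier

/-- `I` is a winning strategy, given as a set of positions, for Duplicator in the bijective game on
`A` and `B` with `m` pebbles in which Spoiler moves at most `r` pebbles at a time: Duplicator
chooses a bijection `h`, then Spoiler moves the pebbles in `J` to pairs of elements matched by
`h`. -/
structure BackAndForth {σ : FirstOrder.Language.{0, 0}} (A B : FinStr σ) (r m : ℕ)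
    (I : (Fin m → A.carrier) → (Fin m → B.carrier) → Prop) : Prop where
  eq_iff : ∀ α β, I α β → ∀ i j, α i = α j ↔ β i = β j
  rel_iff : ∀ α β, I α β → ∀ (n : ℕ) (R : σ.Relations n) (x : Fin n → Fin m),
    (fun i => α (x i)) ∈ A.relation R ↔ (fun i => β (x i)) ∈ B.relation R
  exists_equiv : ∀ α β, I α β → ∃ h : A.carrier ≃ B.carrier,
    ∀ J : Finset (Fin m), J.card ≤ r → ∀ α' β', (∀ i ∉ J, α' i = α i ∧ β' i = β i) →
      (∀ i ∈ J, β' i = h (α' i)) → I α' β'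

theorem BackAndForth.realize_iff {σ : FirstOrder.Language.{0, 0}} {A B : FinStr σ} {r m : ℕ}
    {I : (Fin m → A.carrier) → (Fin m → B.carrier) → Prop} (hI : BackAndForth A B r m I)
    (hr : 1 ≤ r) {𝒬 : Set Quantifier} (h𝒬 : ∀ Q ∈ 𝒬, Q.ArityLE r) (φ : Formula σ 𝒬 m)
    {α : Fin m → A.carrier} {β : Fin m → B.carrier} (h : I α β) :
    φ.Realize A α ↔ φ.Realize B β := by
  induction φ generalizing α β with
  | eq x y => exact hI.eq_iff α β h x y
  | rel R x => exact hI.rel_iff α β h _ R x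
  | not φ ih => exact not_congr (ih h)
  | conj ι φ ih => exact forall_congr' fun i => ih i h
  | ex x φ ih =>
    obtain ⟨p, hp⟩ := hI.exists_equiv α β h
    have hmove : ∀ a, I (Function.update α x a) (Function.update β x (p a)) := fun a =>
      hp {x} (by simpa using hr) _ _
        (fun i hi => by simp [Function.update_of_ne (Finset.notMem_singleton.1 hi)])
        fun i hi => by simp [Finset.mem_singleton.1 hi]
    exact (exists_congr fun a => ih (hmove a)).trans
      (p.surjective.exists (p := fun b => φ.Realize B (Function.update β x b))).symm
  | quant Q hQ y hy ψ ih =>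
    obtain ⟨p, hp⟩ := hI.exists_equiv α β h
    suffices hmove : ∀ n R (b : Fin n → A.carrier),
        I (Function.extend (y n R) b α) (Function.extend (y n R) (p ∘ b) β) from
      Q.mem_iff_of_equiv p fun n R b => (ih n R (hmove n R b)).symm
    intro n R b
    refine hp (Finset.univ.image (y n R)) ?_ _ _ (fun i hi => ?_) fun i hi => ?_
    · exact Finset.card_image_le.trans (by simpa using h𝒬 Q hQ n ⟨R⟩)
    · have hrange : ¬ ∃ j, y n R j = i := by simpa using hi
      exact ⟨Function.extend_apply' _ _ _ hrange, Function.extend_apply' _ _ _ hrange⟩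
    · obtain ⟨j, -, rfl⟩ := Finset.mem_image.1 hi
      rw [(hy n R).extend_apply, (hy n R).extend_apply, Function.comp_apply]

theorem not_logicLE_of_backAndForth {𝒬 𝒬' : Set Quantifier} {Q : Quantifier} (hQ : Q ∈ 𝒬')
    {r s : ℕ} (hs : Q.ArityLE s) (hr : 1 ≤ r) (h𝒬 : ∀ Q ∈ 𝒬, Q.ArityLE r)
    (hgame : ∀ m, ∃ A ∈ Q.K, ∃ B ∉ Q.K, ∃ I, BackAndForth A B r m I ∧ ∃ α β, I α β) :
    ¬ LogicLE 𝒬' 𝒬 := by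
  intro hle
  obtain ⟨m, φ, hφ, hdef⟩ := hle Q.voc inferInstance inferInstance s (Q.sentence hQ hs)
    (Quantifier.isSentence_sentence hQ hs)
  simp only [Quantifier.holds_sentence_iff] at hdef
  obtain ⟨A, hA, B, hB, I, hI, α, β, h⟩ := hgame m
  refine hB ((hdef B).2 ((hφ.holds_iff B β).2 ((hI.realize_iff hr h𝒬 φ h).1 ?_)))
  exact (hφ.holds_iff A α).1 ((hdef A).1 hA)

/-! ### The quantifier of a code -/

/-- Symbols for the cosets of a subgroup of `F ^ n`: an `n`-ary one for each representative `c`. -/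
inductive CosetSymbol (n : ℕ) (F : Type) : ℕ → Type
  | mk (c : Fin n → F) : CosetSymbol n F n

/-- The relational vocabulary with the symbols `CosetSymbol n F`. -/
def cosetLanguage (n : ℕ) (F : Type) : FirstOrder.Language.{0, 0} where
  Functions _ := Empty
  Relations := CosetSymbol n F

section CosetLanguage

variable {n : ℕ} {F : Type}

instance : (cosetLanguage n F).IsRelational := fun _ => inferInstanceAs (IsEmpty Empty)

instance [Finite F] : Finite (Σ k : ℕ, (cosetLanguage n F).Relations k) := by
  refine Finite.of_surjective
    (fun c : Fin n → F => (⟨n, CosetSymbol.mk c⟩ : Σ k, (cosetLanguage n F).Relations k)) ?_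
  rintro ⟨_, ⟨c⟩⟩
  exact ⟨c, rfl⟩

/-- The relation symbol for the coset of `c`. -/
def cosetRel (c : Fin n → F) : (cosetLanguage n F).Relations n :=
  CosetSymbol.mk c

end CosetLanguage

section CosetQuantifier

variable {F : Type} [AddCommGroup F] [Finite F] {n : ℕ} (R : AddSubgroup (Fin n → F))

/-- The structure on `F` whose relations are the cosets of `R`. -/
def cosetTemplate : FinStr (cosetLanguage n F) where
  carrier := F
  str :=
    { funMap := fun {_} f _ => isEmptyElim f
      RelMap := fun {_} s => match s with
        | .mk c => fun x => x - c ∈ R }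
  finite := inferInstance
  nonempty := ⟨0⟩

variable {R} in
theorem mem_CSP_cosetTemplate {A : FinStr (cosetLanguage n F)} :
    A ∈ CSP (cosetTemplate R) ↔
      ∃ h : A.carrier → F, ∀ c, ∀ x ∈ A.relation (cosetRel c), h ∘ x - c ∈ R := by
  constructor
  · rintro ⟨h⟩
    exact ⟨h, fun c x hx => h.map_rel' (cosetRel c) x hx⟩
  · rintro ⟨h, hh⟩
    refine ⟨⟨h, fun {_} f _ => isEmptyElim f, ?_⟩⟩
    rintro _ ⟨c⟩ x hx
    exact hh c x hx

/-- The CSP quantifier of `cosetTemplate R`. -/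
def cosetQuantifier : Quantifier where
  voc := cosetLanguage n F
  relational := inferInstance
  finite := inferInstance
  K := CSP (cosetTemplate R)
  iso_closed := fun _ _ ⟨e⟩ ⟨h⟩ => ⟨h.comp e.symm.toHom⟩

theorem arityLE_cosetQuantifier : (cosetQuantifier R).ArityLE n := by
  rintro _ ⟨⟨c⟩⟩
  exact le_rfl

theorem eq_or_eq_of_mem_nearUnanimity {ℓ : ℕ} (hℓ : 3 ≤ ℓ) {A : Type} {a : Fin ℓ → A} {b : A}
    (h : b ∈ nearUnanimity ℓ A a) {i j : Fin ℓ} (hij : i ≠ j) : a i = b ∨ a j = b := by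
  rw [mem_nearUnanimity hℓ] at h
  have hcompl : {i : Fin ℓ | a i = b}ᶜ.ncard ≤ 1 := by
    have hcard := Set.ncard_add_ncard_compl {i : Fin ℓ | a i = b}
    rw [Nat.card_eq_fintype_card, Fintype.card_fin] at hcard
    omega
  by_contra! hne
  exact hij ((Set.ncard_le_one (Set.toFinite _)).1 hcompl i hne.1 j hne.2)

variable {R}

theorem cosetQuantifier_mem_nuCSPQuantifiers {K ℓ : ℕ} (hR : IsMDS K R) (hK : 3 * K ≤ n)
    (hℓ : 3 ≤ ℓ) : cosetQuantifier R ∈ nuCSPQuantifiers ℓ n := by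
  refine ⟨⟨cosetTemplate R, rfl⟩, ?_, arityLE_cosetQuantifier R⟩
  intro (B : FinStr (cosetLanguage n F)) hB rel hrel
  obtain ⟨h, hh⟩ := mem_CSP_cosetTemplate.1 hB
  refine mem_CSP_cosetTemplate.2 ⟨h, fun c x hx => ?_⟩
  obtain hx | ⟨M, hM, hxM⟩ := hrel n (cosetRel c) hx
  · exact hh c x hx
  · refine hR.mem_of_majority (by simpa using hK)
      (M := fun a => h ∘ M (Fin.castLE hℓ a) - c) (fun a => hh c _ (hM _)) fun j a b hab => ?_
    refine (eq_or_eq_of_mem_nearUnanimity hℓ (hxM j) ((Fin.castLE_injective hℓ).ne hab)).imp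
      (congrArg (h · - c j)) (congrArg (h · - c j))

end CosetQuantifier

/-! ### Duplicator's strategy -/

section SystemStr

variable {F : Type} [AddCommGroup F] [Finite F] {n : ℕ} (R : AddSubgroup (Fin n → F))
  {E V : Type} [Finite V] [Nonempty V] (f : E → Fin n → V) (d : E → Fin n → F)

/-- The structure on `V × F` encoding the system of constraints `Sat f R d`. The sign of `d` is
chosen such that `(v, a) ↦ a + z v` is a homomorphism to `cosetTemplate R` if `z` is a solution. -/
def systemStr : FinStr (cosetLanguage n F) where
  carrier := V × F
  str :=
    { funMap := fun {_} f _ => isEmptyElim f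
      RelMap := fun {_} s => match s with
        | .mk c => fun x => ∃ e, Prod.fst ∘ x = f e ∧ Prod.snd ∘ x + d e - c ∈ R }
  finite := inferInstance
  nonempty := inferInstance

variable {R f d}

theorem mem_relation_systemStr {c : Fin n → F} {x : Fin n → V × F} :
    x ∈ (systemStr R f d).relation (cosetRel c) ↔
      ∃ e, Prod.fst ∘ x = f e ∧ Prod.snd ∘ x + d e - c ∈ R :=
  Iff.rfl

theorem systemStr_mem_CSP_iff :
    systemStr R f d ∈ CSP (cosetTemplate R) ↔ ∃ z : V → F, ∀ e, Sat f R d z e := by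
  refine mem_CSP_cosetTemplate.trans ⟨?_, ?_⟩
  · rintro ⟨(h : V × F → F), hh⟩
    refine ⟨fun v => h (v, 0), fun e => hh (d e) (fun i => (f e i, 0)) ⟨e, rfl, ?_⟩⟩
    have hzero : Prod.snd ∘ (fun i => (f e i, (0 : F))) + d e - d e = 0 := by
      ext
      simp
    exact hzero ▸ R.zero_mem
  · rintro ⟨z, hz⟩
    refine ⟨fun q : V × F => q.2 + z q.1, fun c (x : Fin n → V × F) hx => ?_⟩
    obtain ⟨e, hxe, hx⟩ := mem_relation_systemStr.1 hx
    have hsum : (fun q : V × F => q.2 + z q.1) ∘ x - c =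
        (Prod.snd ∘ x + d e - c) + (z ∘ f e - d e) := by
      rw [← hxe]
      ext i
      simp only [Pi.add_apply, Pi.sub_apply, Function.comp_apply]
      abel
    exact hsum ▸ R.add_mem hx (hz e)

/-- The permutation `(v, a) ↦ (v, a - x v)` of `V × F`, which is a partial isomorphism from
`systemStr R f 0` to `systemStr R f d` on the constraints solved by `x`. -/
def shift (x : V → F) : V × F ≃ V × F :=
  Equiv.prodShear (.refl V) fun v => Equiv.subRight (x v)

theorem shift_comp_mem_relation_iff {x : V → F} {c : Fin n → F} {p : Fin n → V × F}
    (hp : ∀ e, Prod.fst ∘ p = f e → Sat f R d x e) :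
    shift x ∘ p ∈ (systemStr R f d).relation (cosetRel c) ↔
      p ∈ (systemStr R f 0).relation (cosetRel c) := by
  refine mem_relation_systemStr.trans (Iff.trans ?_ mem_relation_systemStr.symm)
  refine exists_congr fun e => and_congr_right fun (hpe : Prod.fst ∘ p = f e) => ?_
  have hdiff : Prod.snd ∘ p + (0 : E → Fin n → F) e - c =
      (Prod.snd ∘ shift x ∘ p + d e - c) + (x ∘ f e - d e) := by
    rw [← hpe]
    ext i
    simp only [shift, Pi.add_apply, Pi.sub_apply, Pi.zero_apply, Function.comp_apply,
      Equiv.prodShear_apply, Equiv.subRight_apply]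
    abel
  rw [hdiff, R.add_mem_cancel_right (hp e hpe)]

end SystemStr

section ShiftPosition

variable {F : Type} [AddCommGroup F] {n : ℕ} (R : AddSubgroup (Fin n → F)) {E V : Type}
  [DecidableEq V] [Nonempty V] [Finite E] (f : E → Fin n → V) (d : E → Fin n → F)

/-- The positions of Duplicator's strategy: the pebbles are matched by `shift x` for an assignment
`x` which is extendable from the variables under the pebbles. -/
def ShiftPosition {m : ℕ} (α β : Fin m → V × F) : Prop :=
  ∃ x : V → F, Extendable f R d (Finset.univ.image (Prod.fst ∘ α)) x ∧ β = shift x ∘ α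

variable {R f d}

theorem exists_shiftPosition {r : ℕ} (hR : IsMDS (r + 4) R)
    (hr : 1 ≤ r) {m : ℕ} (hf : Expanding f (4 * m)) :
    ∃ α β : Fin m → V × F, ShiftPosition R f d α β := by
  have hempty : Extendable f R d ∅ 0 := fun S hS => ⟨0, by simp, by
    simp [Finset.card_eq_zero.1 (Nat.le_zero.1 hS)]⟩
  obtain ⟨y, -, hy⟩ := hempty.exists_extension hR hf (by simp)
  let v := Classical.arbitrary V
  refine ⟨fun _ => (v, 0), _, y, hy {v} (by simpa using hr) _ ?_
    (Finset.card_image_le.trans (Finset.card_fin m).le), rfl⟩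
  exact Finset.image_subset_iff.2 fun i _ => by simp

theorem backAndForth_systemStr [Finite F] [Finite V] [NeZero n] {r m : ℕ}
    (hR : IsMDS (r + 4) R) (hf : Expanding f (4 * m)) :
    BackAndForth (systemStr R f 0) (systemStr R f d) r m (ShiftPosition R f d) := by
  refine ⟨?_, ?_, ?_⟩
  · rintro α _ ⟨x, -, rfl⟩ i j
    exact (shift x).apply_eq_iff_eq.symm
  · rintro α _ ⟨x, hx, rfl⟩ _ ⟨c⟩ p
    refine (shift_comp_mem_relation_iff (p := α ∘ p) fun e hpe => hx.sat fun i => ?_).symm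
    exact Finset.mem_image.2 ⟨p i, Finset.mem_univ _, congrFun hpe i⟩
  · rintro (α : Fin m → V × F) _ ⟨x, hx, rfl⟩
    obtain ⟨y, hyx, hy⟩ :=
      hx.exists_extension hR hf (Finset.card_image_le.trans (Finset.card_fin m).le)
    refine ⟨shift y, fun J hJ (α' : Fin m → V × F) β' hfixed hmoved => ⟨y, ?_, ?_⟩⟩
    · refine hy (J.image (Prod.fst ∘ α')) (Finset.card_image_le.trans hJ) _ ?_
        (Finset.card_image_le.trans (Finset.card_fin m).le)
      refine Finset.image_subset_iff.2 fun i _ => Finset.mem_union.2 ?_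
      by_cases hi : i ∈ J
      · exact .inr (Finset.mem_image_of_mem _ hi)
      · rw [Function.comp_apply, (hfixed i hi).1]
        exact .inl (Finset.mem_image_of_mem _ (Finset.mem_univ i))
    · funext i
      by_cases hi : i ∈ J
      · exact hmoved i hi
      · have hyi : y (α i).1 = x (α i).1 := hyx (by simp)
        rw [(hfixed i hi).2, Function.comp_apply, Function.comp_apply, (hfixed i hi).1]
        exact Prod.ext rfl (congrArg ((α i).2 - ·) hyi.symm)

end ShiftPosition

theorem not_logicLE_of_isMDS {F : Type} [AddCommGroup F] [Finite F] [Nontrivial F] {n r : ℕ}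
    {R : AddSubgroup (Fin n → F)} (hR : IsMDS (r + 4) R) (hr : 1 ≤ r) (hn : r + 6 ≤ n)
    {𝒬 𝒬' : Set Quantifier} (h𝒬 : ∀ Q ∈ 𝒬, Q.ArityLE r) (h𝒬' : cosetQuantifier R ∈ 𝒬') :
    ¬ LogicLE 𝒬' 𝒬 := by
  refine not_logicLE_of_backAndForth h𝒬' (arityLE_cosetQuantifier R) hr h𝒬 fun m => ?_
  obtain ⟨N, f, hf⟩ := exists_expanding (ι := Fin n) (by simp; omega) (4 * m)
  have hcard : Nat.card R * Nat.card F < Nat.card F ^ Fintype.card (Fin n) := by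
    calc Nat.card R * Nat.card F ≤ Nat.card F ^ (r + 4) * Nat.card F :=
          Nat.mul_le_mul_right _ (hR.card_le (by simp; omega))
      _ = Nat.card F ^ (r + 5) := (pow_succ _ _).symm
      _ < _ := Nat.pow_lt_pow_right Finite.one_lt_card (by simp; omega)
  obtain ⟨d, hd⟩ := exists_unsatisfiable (f := f) le_rfl hcard
  have : NeZero n := ⟨by omega⟩
  refine ⟨systemStr R f 0, systemStr_mem_CSP_iff.2 ⟨0, fun e => ?_⟩, systemStr R f d,
    fun hmem => ?_, ShiftPosition R f d, backAndForth_systemStr hR hf,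
    exists_shiftPosition hR hr hf⟩
  · simp [Sat]
  · obtain ⟨z, hz⟩ := systemStr_mem_CSP_iff.1 hmem
    obtain ⟨e, he⟩ := hd z
    exact he (hz e)

theorem logicLT_nuCSPQuantifiers {ℓ r r' : ℕ} (hℓ : 3 ≤ ℓ) (hr' : 3 * (r + 5) ≤ r') :
    LogicLT (nuCSPQuantifiers ℓ r) (nuCSPQuantifiers ℓ r') := by
  refine ⟨.of_subset (nuCSPQuantifiers_mono ℓ (by omega)), ?_⟩
  obtain ⟨p, hp, hprime⟩ := Nat.exists_infinite_primes (3 * (r + 5))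
  have : Fact p.Prime := ⟨hprime⟩
  obtain ⟨α⟩ : Nonempty (Fin (3 * (r + 5)) ↪ ZMod p) :=
    Function.Embedding.nonempty_of_card_le (by simpa [ZMod.card] using hp)
  have hR := isMDS_reedSolomon α.injective (r + 1 + 4)
  exact not_logicLE_of_isMDS hR (Nat.le_add_left 1 r) (by omega)
    (fun Q hQ => hQ.2.2.mono (Nat.le_succ r))
    (nuCSPQuantifiers_mono ℓ hr' (cosetQuantifier_mem_nuCSPQuantifiers hR (by omega) hℓ))

end GenQuant

theorem mainTheorem12_general (ℓ r : ℕ) (hℓ : 3 ≤ ℓ) :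
    (∃ r' : ℕ, r < r' ∧
      GenQuant.LogicLT (GenQuant.nuCSPQuantifiers ℓ r) (GenQuant.nuCSPQuantifiers ℓ r')) ∧
    (∃ f : ℕ → ℕ, f 0 = r ∧ StrictMono f ∧ ∀ n : ℕ,
      GenQuant.LogicLT (GenQuant.nuCSPQuantifiers ℓ (f n))
        (GenQuant.nuCSPQuantifiers ℓ (f (n + 1)))) := by
  let next : ℕ → ℕ := fun s => 3 * (s + 5)
  have hlt : ∀ s, s < next s := fun s => by simp only [next]; omega
  have hLT : ∀ s, GenQuant.LogicLT (GenQuant.nuCSPQuantifiers ℓ s)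
      (GenQuant.nuCSPQuantifiers ℓ (next s)) := fun s => GenQuant.logicLT_nuCSPQuantifiers hℓ le_rfl
  refine ⟨⟨next r, hlt r, hLT r⟩, fun n => next^[n] r, rfl, strictMono_nat_of_lt_succ fun n => ?_,
    fun n => ?_⟩
  · simpa only [Function.iterate_succ_apply'] using hlt _
  · simpa only [Function.iterate_succ_apply'] using hLT _

theorem mainTheorem12 (ℓ r : ℕ) (hℓ : 3 ≤ ℓ) (hr : ℓ ≤ r) :
    (∃ r' : ℕ, r < r' ∧
      GenQuant.LogicLT (GenQuant.nuCSPQuantifiers ℓ r) (GenQuant.nuCSPQuantifiers ℓ r')) ∧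
    (∃ f : ℕ → ℕ, f 0 = r ∧ StrictMono f ∧ ∀ n : ℕ,
      GenQuant.LogicLT (GenQuant.nuCSPQuantifiers ℓ (f n))
        (GenQuant.nuCSPQuantifiers ℓ (f (n + 1)))) :=
  mainTheorem12_general ℓ r hℓ
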